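/- A continuum is a nonempty compact connected metric space. An arc is a homeomorphic copy of $[0,1]$; a space is arcwise connected (uniquely arcwise connected) if any two distinct points are the end points of some arc (of exactly one arc) in it. The arc component of a point consists of that point and all points that can be joined to it by an arc. A uniquely arcwise connected continuum $X$ is uniformly arcwise connected if for each $\varepsilon>0$ there is a positive integer $n$ such that every arc in $X$ contains $n$ points that cut it into subarcs of diameter less than $\varepsilon$. For a Hausdorff space $X$, let $\mathcal S_c(X)$ be the set of all nontrivial convergent sequences in $X$, that is, of all compact, countably infinite sets $S\subseteq X$ for which there is $x\in S$ such that $S\setminus U$ is finite for every open $U\ni x$; it carries the Vietoris topology, whose basic open sets are $\{S\in\mathcal S_c(X): S\subseteq U_1\cup\dots\cup U_m,\ S\cap U_i\neq\emptyset \text{ for } i=1,\dots,m\}$ with $U_1,\dots,U_m$ open in $X$. Theorem. Let $X$ be a uniquely arcwise connected continuum. (1) If $X$ is not uniformly arcwise connected, then $\mathcal S_c(X)$ has exactly $\mathfrak c$ arc components, where $\mathfrak c=|\mathbb R|$. (2) If $\mathcal S_c(X)$ is arcwise connected, then $X$ is uniformly arcwise connected. -/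

import Mathlib

open Set TopologicalSpace unitInterval

/-- `A` is an arc in `Y` with end points `x` and `y`: the image of `[0,1]` under a
homeomorphism onto its image sending `0` to `x` and `1` to `y`. -/
def IsArcBetween {Y : Type*} [TopologicalSpace Y] (A : Set Y) (x y : Y) : Prop :=
  ∃ f : I → Y, Topology.IsEmbedding f ∧ f 0 = x ∧ f 1 = y ∧ range f = A

/-- Any two distinct points are the end points of an arc. -/
def IsArcwiseConnected (Y : Type*) [TopologicalSpace Y] : Prop :=
  ∀ x y : Y, x ≠ y → ∃ A : Set Y, IsArcBetween A x y

/-- Any two distinct points are the end points of exactly one arc. -/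
def IsUniquelyArcwiseConnected (Y : Type*) [TopologicalSpace Y] : Prop :=
  ∀ x y : Y, x ≠ y → ∃! A : Set Y, IsArcBetween A x y

/-- For each `ε > 0` there is a positive integer `n` such that in every arc (parametrized by `f`)
there are `n` points `f (t 1), …, f (t n)` that cut it into subarcs of diameter less than `ε`;
here `0 = t 0 < t 1 < … < t n < t (n + 1) = 1`. -/
def IsUniformlyArcwiseConnected (X : Type*) [MetricSpace X] : Prop :=
  ∀ ε : ℝ, 0 < ε → ∃ n : ℕ, 0 < n ∧ ∀ f : I → X, Topology.IsEmbedding f →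
    ∃ t : Fin (n + 2) → I, StrictMono t ∧ t 0 = 0 ∧ t (Fin.last (n + 1)) = 1 ∧
      ∀ i : Fin (n + 1), Metric.diam (f '' Icc (t i.castSucc) (t i.succ)) < ε

/-- The arc component of `x`: the point `x` and all points that an arc joins to `x`.
(In a Hausdorff space, being joined in this sense is an equivalence relation.) -/
def arcComponent {Y : Type*} [TopologicalSpace Y] (x : Y) : Set Y :=
  {y | y = x ∨ ∃ A : Set Y, IsArcBetween A x y}

/-- The set of all arc components of `Y`. -/
def arcComponents (Y : Type*) [TopologicalSpace Y] : Set (Set Y) :=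
  range (arcComponent : Y → Set Y)

/-- `S` is a nontrivial convergent sequence in `X` (as a set containing its limit point). -/
def IsNontrivialConvergentSequence {X : Type*} [TopologicalSpace X] (S : Set X) : Prop :=
  S.Countable ∧ S.Infinite ∧ ∃ x ∈ S, ∀ U : Set X, IsOpen U → x ∈ U → (S \ U).Finite

/-- The hyperspace of all nontrivial convergent sequences in `X`, with the Vietoris topology
(the subspace topology inherited from `NonemptyCompacts X`, whose topology is Vietoris). -/
abbrev ConvergentSequences (X : Type*) [TopologicalSpace X] : Type _ :=
  {S : NonemptyCompacts X // IsNontrivialConvergentSequence (S : Set X)}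

open Filter Topology

/-! Fix `ε` and measure how far apart two points of `X` are by the number of closed pathwise
connected sets of diameter less than `ε` needed to join them (`JoinedBySmallPieces`). Any path with
distinct end points contains an arc with the same ends, so by uniqueness a path joining two points
of an arc runs over the whole subarc between them. Each piece therefore meets an arc in a subarc,
and a bound on the number of pieces bounds the number of cuts
(`IsUniquelyArcwiseConnected.exists_cut`). If `X` is not uniformly arcwise connected, then for some
`ε` the number of pieces needed from a base point is unbounded.

Along a path of convergent sequences this count stays bounded. The sets on the path are compact and
countable, so chains with small steps cannot travel far in them. Hence every point `p` of the
initial set can be followed by a continuous selection whose modulus of continuity does not depend on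
`p`, and one number `n` of pieces serves all `p` (`ConvergentSequences.exists_joinedBySmallPieces`).

Now take a convergent sequence whose terms are farther and farther apart in this count. If two of
its subsequences lie in one arc component, their index sets differ by a finite set only. There are
`𝔠` index sets that pairwise differ infinitely often, and no more than `𝔠` compact sets in all,
which gives (1). Since `𝔠 > 1`, (2) follows. -/

/-! ### Loop erasure of paths -/

/-- Closed subsets of `[0,1]` containing `0` and `1` across whose gaps the path `γ` closes up. -/
def loopErasures {X : Type*} (γ : ℝ → X) : Set (Set ℝ) :=
  {K | IsClosed K ∧ K ⊆ Icc 0 1 ∧ (0 : ℝ) ∈ K ∧ (1 : ℝ) ∈ K ∧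
    ∀ a ∈ K, ∀ b ∈ K, a < b → Disjoint (Ioo a b) K → γ a = γ b}

/-- A point between two points of a closed set but off the set lies in a gap of it. -/
lemma IsClosed.exists_gap {K : Set ℝ} (hK : IsClosed K) {a b c : ℝ} (ha : a ∈ K) (hb : b ∈ K)
    (hac : a ≤ c) (hcb : c ≤ b) (hc : c ∉ K) :
    ∃ a' ∈ K, ∃ b' ∈ K, a ≤ a' ∧ a' < c ∧ c < b' ∧ b' ≤ b ∧ Disjoint (Ioo a' b') K := by
  have h1 : IsCompact (K ∩ Icc a c) := isCompact_Icc.inter_left hK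
  have h2 : IsCompact (K ∩ Icc c b) := isCompact_Icc.inter_left hK
  obtain ⟨a', ⟨ha'K, ha'⟩, hmax⟩ := h1.exists_isGreatest ⟨a, ha, le_rfl, hac⟩
  obtain ⟨b', ⟨hb'K, hb'⟩, hmin⟩ := h2.exists_isLeast ⟨b, hb, hcb, le_rfl⟩
  have hca : a' ≠ c := fun h => hc (h ▸ ha'K)
  have hcb' : b' ≠ c := fun h => hc (h ▸ hb'K)
  refine ⟨a', ha'K, b', hb'K, ha'.1, lt_of_le_of_ne ha'.2 hca, lt_of_le_of_ne hb'.1 hcb'.symm,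
    hb'.2, ?_⟩
  rw [Set.disjoint_left]
  rintro u ⟨hu1, hu2⟩ huK
  rcases le_total u c with h | h
  · exact absurd (hmax ⟨huK, by linarith [ha'.1], h⟩) (not_le.2 hu1)
  · exact absurd (hmin ⟨huK, h, by linarith [hb'.2]⟩) (not_le.2 hu2)

/-- Zorn's lemma. For a gap `(a, b)` of the intersection of a chain, compactness gives a member of
the chain with a gap whose ends are as close to `a` and `b` as desired; `γ` agrees at those ends,
hence at `a` and `b` by continuity. -/
lemma exists_minimal_loopErasure {X : Type*} [MetricSpace X] {γ : ℝ → X} (hγ : Continuous γ) :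
    ∃ K, Minimal (· ∈ loopErasures γ) K := by
  have hI : Icc (0 : ℝ) 1 ∈ loopErasures γ := by
    refine ⟨isClosed_Icc, Subset.rfl, by simp, by simp, fun a ha b hb hab hd => ?_⟩
    exact absurd hd (not_disjoint_iff.2 ⟨(a + b) / 2, ⟨by linarith, by linarith⟩,
      by linarith [ha.1, hb.1], by linarith [ha.2, hb.2]⟩)
  suffices H : ∀ c ⊆ loopErasures γ, IsChain (· ⊆ ·) c → c.Nonempty →
      ∃ lb ∈ loopErasures γ, ∀ s ∈ c, lb ⊆ s from
    (zorn_superset_nonempty (loopErasures γ) H _ hI).imp fun _ h => h.2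
  intro c hc hchain hne
  refine ⟨⋂₀ c, ⟨isClosed_sInter fun K hK => (hc hK).1, ?_, fun K hK => (hc hK).2.2.1,
    fun K hK => (hc hK).2.2.2.1, ?_⟩, fun s hs => sInter_subset_of_mem hs⟩
  · obtain ⟨K, hK⟩ := hne
    exact (sInter_subset_of_mem hK).trans (hc hK).2.1
  intro a ha b hb hab hd
  by_contra hne'
  have hev : ∀ᶠ p : ℝ × ℝ in 𝓝 (a, b), γ p.1 ≠ γ p.2 := by
    exact (isOpen_ne_fun (by fun_prop : Continuous fun p : ℝ × ℝ => γ p.1)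
      (by fun_prop : Continuous fun p : ℝ × ℝ => γ p.2)).mem_nhds hne'
  obtain ⟨η, hη, hball⟩ := Metric.eventually_nhds_iff.1 hev
  -- `η / 2` keeps the ends of the nearby gap where `γ` separates them; `(b - a) / 3` keeps the
  -- midpoint inside `[a + θ, b - θ]`.
  set θ := min (η / 2) ((b - a) / 3) with hθ
  have hθ0 : 0 < θ := lt_min (by linarith) (by linarith)
  have hθ1 : θ ≤ η / 2 := min_le_left _ _
  have hθ2 : θ ≤ (b - a) / 3 := min_le_right _ _
  have hdir : DirectedOn (· ⊇ ·) c := by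
    intro s hs t ht
    rcases hchain.total hs ht with h | h
    · exact ⟨s, hs, Subset.rfl, h⟩
    · exact ⟨t, ht, h, Subset.rfl⟩
  have hex : ∃ K ∈ c, Disjoint (Icc (a + θ) (b - θ)) K := by
    by_contra! hcon
    have : (⋂₀ ((fun K => Icc (a + θ) (b - θ) ∩ K) '' c)).Nonempty := by
      have := hne.image fun K => Icc (a + θ) (b - θ) ∩ K
      have := this.to_subtype
      refine IsCompact.nonempty_sInter_of_directed_nonempty_isCompact_isClosed ?_ ?_ ?_ ?_
      · rintro _ ⟨s, hs, rfl⟩ _ ⟨t, ht, rfl⟩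
        obtain ⟨r, hr, hrs, hrt⟩ := hdir s hs t ht
        exact ⟨_, ⟨r, hr, rfl⟩, inter_subset_inter_right _ hrs, inter_subset_inter_right _ hrt⟩
      · rintro _ ⟨s, hs, rfl⟩
        exact not_disjoint_iff_nonempty_inter.1 (hcon s hs)
      · rintro _ ⟨s, hs, rfl⟩
        exact isCompact_Icc.inter_right (hc hs).1
      · rintro _ ⟨s, hs, rfl⟩
        exact isClosed_Icc.inter (hc hs).1
    obtain ⟨x, hx⟩ := this
    obtain ⟨K, hK⟩ := hne
    have hx1 := (hx _ ⟨K, hK, rfl⟩).1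
    refine Set.disjoint_left.1 hd (show x ∈ Ioo a b from
      ⟨by linarith [hx1.1], by linarith [hx1.2]⟩) ?_
    exact fun s hs => (hx _ ⟨s, hs, rfl⟩).2
  obtain ⟨K, hKc, hKd⟩ := hex
  have hmid : (a + b) / 2 ∉ K := Set.disjoint_left.1 hKd ⟨by linarith, by linarith⟩
  obtain ⟨a', ha', b', hb', h1, h2, h3, h4, h5⟩ := (hc hKc).1.exists_gap (ha K hKc) (hb K hKc)
    (by linarith : a ≤ (a + b) / 2) (by linarith) hmid
  have ha'2 : a' < a + θ := by
    by_contra! h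
    exact Set.disjoint_left.1 hKd ⟨h, by linarith⟩ ha'
  have hb'2 : b - θ < b' := by
    by_contra! h
    exact Set.disjoint_left.1 hKd ⟨by linarith, h⟩ hb'
  refine hball (y := (a', b')) ?_ ((hc hKc).2.2.2.2 a' ha' b' hb' (by linarith) h5)
  rw [Prod.dist_eq, max_lt_iff, Real.dist_eq, Real.dist_eq, abs_lt, abs_lt]
  exact ⟨⟨by linarith, by linarith⟩, ⟨by linarith, by linarith⟩⟩

/-- Cutting `(s, t)` out of `K` creates no gap except `(s, t)` itself, across which `γ` closes up;
minimality then says that nothing was removed. -/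
lemma Minimal.disjoint_Ioo_of_loopErasure {X : Type*} {γ : ℝ → X} {K : Set ℝ}
    (hK : Minimal (· ∈ loopErasures γ) K) {s t : ℝ} (hs : s ∈ K) (ht : t ∈ K) (hst : s < t)
    (heq : γ s = γ t) : Disjoint (Ioo s t) K := by
  obtain ⟨hcl, hsub, h0, h1, hgap⟩ := hK.prop
  have hmem : K \ Ioo s t ∈ loopErasures γ := by
    refine ⟨hcl.sdiff isOpen_Ioo, sdiff_subset.trans hsub, ⟨h0, fun h => ?_⟩, ⟨h1, fun h => ?_⟩, ?_⟩
    · linarith [h.1, (hsub hs).1]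
    · linarith [h.2, (hsub ht).2]
    rintro a ⟨ha, ha'⟩ b ⟨hb, hb'⟩ hab hd
    by_cases hdK : Disjoint (Ioo a b) K
    · exact hgap a ha b hb hab hdK
    obtain ⟨u, hu, huK⟩ := not_disjoint_iff.1 hdK
    have hu' : u ∈ Ioo s t := by
      by_contra h
      exact Set.disjoint_left.1 hd hu ⟨huK, h⟩
    have has : a ≤ s := by
      by_contra! h
      exact ha' ⟨h, hu.1.trans hu'.2⟩
    have htb : t ≤ b := by
      by_contra! h
      exact hb' ⟨hu'.1.trans hu.2, h⟩
    have has' : a = s := by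
      by_contra h
      exact Set.disjoint_left.1 hd (show s ∈ Ioo a b from
        ⟨lt_of_le_of_ne has h, by linarith⟩) ⟨hs, by simp⟩
    have htb' : t = b := by
      by_contra h
      exact Set.disjoint_left.1 hd (show t ∈ Ioo a b from
        ⟨by linarith, lt_of_le_of_ne htb h⟩) ⟨ht, by simp⟩
    rw [has', heq, htb']
  have := hK.le_of_le hmem sdiff_subset
  rw [Set.disjoint_left]
  exact fun u hu huK => (this huK).2 hu

/-- Erasing the loops of a path: the result has order-connected fibres. -/
lemma exists_orderConnected_fibres {X : Type*} [MetricSpace X] {γ : ℝ → X} (hγ : Continuous γ) :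
    ∃ g : ℝ → X, ContinuousOn g (Icc 0 1) ∧ g 0 = γ 0 ∧ g 1 = γ 1 ∧
      g '' Icc 0 1 ⊆ γ '' Icc 0 1 ∧
      ∀ s ∈ Icc (0 : ℝ) 1, ∀ t ∈ Icc (0 : ℝ) 1, ∀ u ∈ Icc s t, g s = g t → g u = g s := by
  obtain ⟨K, hK⟩ := exists_minimal_loopErasure hγ
  obtain ⟨hcl, hsub, h0, h1, hgap⟩ := hK.prop
  have hl : ∀ t ∈ Icc (0 : ℝ) 1, IsGreatest (K ∩ Icc 0 t) (sSup (K ∩ Icc 0 t)) := fun t ht =>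
    (isCompact_Icc.inter_left hcl).isGreatest_sSup ⟨0, h0, le_rfl, ht.1⟩
  set l : ℝ → ℝ := fun t => sSup (K ∩ Icc 0 t) with hldef
  have hlK : ∀ t ∈ K, l t = t := fun t ht =>
    le_antisymm (hl t (hsub ht)).1.2.2 ((hl t (hsub ht)).2 ⟨ht, (hsub ht).1, le_rfl⟩)
  -- The erased path is `γ ∘ l`, where `l t` is the last point of `K` up to `t`. Although `l` jumps,
  -- `γ (l s)` is also the value of `γ` at the first point `s'` of `K` from `s` on, so values at `s`
  -- and `t` are compared through points of `[s, t]`.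
  have key : ∀ s ∈ Icc (0 : ℝ) 1, ∀ t ∈ Icc (0 : ℝ) 1, s ≤ t →
      (l s = l t ∧ Disjoint K (Icc s t)) ∨
        (l t ∈ Icc s t ∧ ∃ s' ∈ K, s ≤ s' ∧ s' ≤ l t ∧ γ (l s) = γ s' ∧
          ∀ u ∈ K, s ≤ u → s' ≤ u) := by
    intro s hs t ht hst
    by_cases hd : Disjoint K (Icc s t)
    · left
      refine ⟨?_, hd⟩
      have : K ∩ Icc 0 s = K ∩ Icc 0 t := by
        ext u
        constructor
        · rintro ⟨h, h2, h3⟩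
          exact ⟨h, h2, h3.trans hst⟩
        · rintro ⟨h, h2, h3⟩
          refine ⟨h, h2, ?_⟩
          by_contra! h4
          exact Set.disjoint_left.1 hd h ⟨h4.le, h3⟩
      simp only [hldef, this]
    · right
      obtain ⟨w, hwK, hw⟩ := not_disjoint_iff.1 hd
      have hwl : w ≤ l t := (hl t ht).2 ⟨hwK, hs.1.trans hw.1, hw.2⟩
      refine ⟨⟨hw.1.trans hwl, (hl t ht).1.2.2⟩, ?_⟩
      by_cases hsK : s ∈ K
      · exact ⟨s, hsK, le_rfl, hw.1.trans hwl, by rw [hlK s hsK], fun u _ h => h⟩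
      obtain ⟨a, haK, b, hbK, -, has, hsb, hbw, hab⟩ := hcl.exists_gap h0 hwK hs.1 hw.1 hsK
      have hla : l s = a := by
        refine le_antisymm ?_ ((hl s hs).2 ⟨haK, (hsub haK).1, has.le⟩)
        by_contra! h
        exact Set.disjoint_left.1 hab ⟨h, (hl s hs).1.2.2.trans_lt hsb⟩ (hl s hs).1.1
      refine ⟨b, hbK, hsb.le, hbw.trans hwl, ?_, fun u hu hsu => ?_⟩
      · rw [hla]
        exact hgap a haK b hbK (has.trans hsb) hab
      · by_contra! h
        exact Set.disjoint_left.1 hab ⟨has.trans_le hsu, h⟩ hu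
  refine ⟨fun t => γ (l t), ?_, by simp [hlK 0 h0], by simp [hlK 1 h1], ?_, ?_⟩
  · have huc : UniformContinuousOn γ (Icc 0 1) :=
      isCompact_Icc.uniformContinuousOn_of_continuous hγ.continuousOn
    apply UniformContinuousOn.continuousOn
    rw [Metric.uniformContinuousOn_iff] at huc ⊢
    intro ε hε
    obtain ⟨δ, hδ, H⟩ := huc ε hε
    have main : ∀ s ∈ Icc (0 : ℝ) 1, ∀ t ∈ Icc (0 : ℝ) 1, s ≤ t → dist s t < δ →
        dist (γ (l s)) (γ (l t)) < ε := by
      intro s hs t ht hst hd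
      rcases key s hs t ht hst with ⟨h, -⟩ | ⟨h, s', hs'K, hs1, hs2, h3, -⟩
      · rw [h, dist_self]
        exact hε
      · rw [h3]
        refine H s' (hsub hs'K) _ (hsub (hl t ht).1.1) ?_
        rw [Real.dist_eq, abs_lt] at hd ⊢
        constructor <;> linarith [h.1, h.2]
    refine ⟨δ, hδ, fun s hs t ht hd => ?_⟩
    rcases le_total s t with h | h
    · exact main s hs t ht h hd
    · rw [dist_comm] at hd ⊢
      exact main t ht s hs h hd
  · rintro _ ⟨t, ht, rfl⟩
    exact ⟨l t, hsub (hl t ht).1.1, rfl⟩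
  · intro s hs t ht u hu heq
    have hu01 : u ∈ Icc (0 : ℝ) 1 := ⟨hs.1.trans hu.1, hu.2.trans ht.2⟩
    rcases key s hs u hu01 hu.1 with ⟨h, -⟩ | ⟨h, s', hs'K, hs1, hs2, h3, hmin⟩
    · simp only [h]
    have hluK := (hl u hu01).1.1
    have hltK := (hl t ht).1.1
    have hlt : l u ≤ l t := (hl t ht).2 ⟨hluK, (hsub hluK).1, h.2.trans hu.2⟩
    simp only at heq ⊢
    rcases hs2.eq_or_lt with h4 | h4
    · rw [h3, h4]
    rcases hlt.eq_or_lt with h5 | h5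
    · rw [h5, heq]
    exact absurd hluK (Set.disjoint_left.1
      (hK.disjoint_Ioo_of_loopErasure hs'K hltK (h4.trans h5) (h3.symm.trans heq)) ⟨h4, h5⟩)

/-! ### Reparametrization: every path contains an arc -/

/-- The largest distance from `g q` to a point of `g` on `[q, t]`. -/
noncomputable def excursion {X : Type*} [MetricSpace X] (g : ℝ → X) (q t : ℝ) : ℝ :=
  sSup ((fun u => dist (g (q + u * (max t q - q))) (g q)) '' Icc (0 : ℝ) 1)

section excursion

variable {X : Type*} [MetricSpace X] {g : ℝ → X}

lemma continuous_excursion (hg : Continuous g) (q : ℝ) : Continuous (excursion g q) :=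
  isCompact_Icc.continuous_sSup (f := fun t u => dist (g (q + u * (max t q - q))) (g q))
    (by simp only [Function.HasUncurry.uncurry, id]; fun_prop)

lemma isLUB_excursion (hg : Continuous g) (q t : ℝ) :
    IsLUB ((fun s => dist (g s) (g q)) '' Icc q (max t q)) (excursion g q t) := by
  have h : (fun u => dist (g (q + u * (max t q - q))) (g q)) '' Icc (0 : ℝ) 1 =
      (fun s => dist (g s) (g q)) '' Icc q (max t q) := by
    have h1 : (fun u : ℝ => q + u * (max t q - q)) '' Icc (0 : ℝ) 1 = Icc q (max t q) := by
      rw [← segment_eq_Icc (le_max_right t q), segment_eq_image']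
      rfl
    rw [← h1, image_image]
  rw [excursion, h]
  exact (isCompact_Icc.image (by fun_prop)).isLUB_sSup
    ((nonempty_Icc.2 (le_max_right t q)).image _)

lemma excursion_nonneg (hg : Continuous g) (q t : ℝ) : 0 ≤ excursion g q t :=
  (isLUB_excursion hg q t).1 ⟨q, ⟨le_rfl, le_max_right _ _⟩, dist_self _⟩

lemma excursion_mono (hg : Continuous g) (q : ℝ) : Monotone (excursion g q) := fun _ _ h =>
  (isLUB_excursion hg q _).mono (isLUB_excursion hg q _)
    (image_mono (Icc_subset_Icc_right (max_le_max_right q h)))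

lemma excursion_of_le (hg : Continuous g) {q t : ℝ} (h : t ≤ q) : excursion g q t = 0 := by
  refine le_antisymm ((isLUB_excursion hg q t).2 ?_) (excursion_nonneg hg q t)
  rintro _ ⟨s, hs, rfl⟩
  rw [max_eq_right h, Icc_self, mem_singleton_iff] at hs
  simp [hs]

end excursion

/-- A map with order-connected fibres has the fibres of a monotone real function. -/
lemma exists_monotone_same_fibres {X : Type*} [MetricSpace X] [CompactSpace X] {g : ℝ → X}
    (hg : Continuous g) (hfib : ∀ s t, ∀ u ∈ Icc s t, g s = g t → g u = g s) :
    ∃ h : ℝ → ℝ, Continuous h ∧ Monotone h ∧ ∀ s t, h s = h t ↔ g s = g t := by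
  set D := Metric.diam (univ : Set X)
  have hle : ∀ q t, excursion g q t ≤ D := by
    intro q t
    refine (isLUB_excursion hg q t).2 ?_
    rintro _ ⟨s, -, rfl⟩
    exact Metric.dist_le_diam_of_mem isCompact_univ.isBounded (mem_univ _) (mem_univ _)
  set q := denseSeq ℝ
  -- Each excursion is continuous and monotone in `t`; the weighted sum over a dense set of starting
  -- points increases exactly when `g` moves.
  set F : ℕ → ℝ → ℝ := fun n t => (1 / 2 : ℝ) ^ n * excursion g (q n) t with hF
  have hsumD : Summable fun n : ℕ => (1 / 2 : ℝ) ^ n * D := summable_geometric_two.mul_right D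
  have hbound : ∀ n t, ‖F n t‖ ≤ (1 / 2 : ℝ) ^ n * D := by
    intro n t
    rw [Real.norm_of_nonneg (mul_nonneg (by positivity) (excursion_nonneg hg _ _))]
    exact mul_le_mul_of_nonneg_left (hle _ _) (by positivity)
  have hsum : ∀ t, Summable fun n => F n t := fun t =>
    Summable.of_norm_bounded hsumD fun n => hbound n t
  have hmono : ∀ n, Monotone (F n) := fun n s t hst =>
    mul_le_mul_of_nonneg_left (excursion_mono hg _ hst) (by positivity)
  have hM : Monotone fun t => ∑' n, F n t := fun s t hst =>
    (hsum s).tsum_le_tsum (fun n => hmono n hst) (hsum t)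
  have hone : ∀ s t, s ≤ t → ((∑' n, F n s = ∑' n, F n t) ↔ g s = g t) := by
    intro s t hst
    constructor
    · intro h
      by_contra hne
      have hst' : s < t := lt_of_le_of_ne hst fun h => hne (by rw [h])
      have hopen : IsOpen {u | g u ≠ g t} := isOpen_ne_fun hg continuous_const
      obtain ⟨b, hb, hsub⟩ := exists_Ico_subset_of_mem_nhds (hopen.mem_nhds hne) ⟨t, hst'⟩
      -- A starting point just after `s`, where `g` still differs from `g t`: its excursion vanishes
      -- at `s` and is positive at `t`.
      obtain ⟨n, hn⟩ := (denseRange_denseSeq ℝ).exists_mem_open isOpen_Ioo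
        (nonempty_Ioo.2 (lt_min hst' hb))
      have hn1 : s < q n := hn.1
      have hn2 : q n < t := hn.2.trans_le (min_le_left _ _)
      have hn3 : g (q n) ≠ g t := hsub ⟨hn1.le, hn.2.trans_le (min_le_right _ _)⟩
      refine h.not_lt ((hsum s).tsum_lt_tsum (i := n) (fun n => hmono n hst) ?_ (hsum t))
      refine mul_lt_mul_of_pos_left ?_ (by positivity)
      rw [excursion_of_le hg hn1.le]
      exact (dist_pos.2 hn3.symm).trans_le ((isLUB_excursion hg (q n) t).1
        ⟨t, ⟨hn2.le, le_max_left _ _⟩, rfl⟩)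
    · intro h
      refine tsum_congr fun n => ?_
      simp only [hF]
      congr 1
      refine le_antisymm (excursion_mono hg _ hst) ((isLUB_excursion hg _ _).2 ?_)
      rintro _ ⟨u, hu, rfl⟩
      rcases le_or_gt u s with hus | hus
      · exact (isLUB_excursion hg _ _).1 ⟨u, ⟨hu.1, hus.trans (le_max_left _ _)⟩, rfl⟩
      rcases le_or_gt u (q n) with huq | huq
      · simp [le_antisymm huq hu.1, excursion_nonneg hg]
      have hut : u ≤ t := by
        rcases le_max_iff.1 hu.2 with h | h
        · exact h
        · exact absurd h (not_le.2 huq)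
      have hgu : g u = g s := hfib s t u ⟨hus.le, hut⟩ h
      rcases le_or_gt (q n) s with hqs | hqs
      · exact (isLUB_excursion hg _ _).1 ⟨s, ⟨hqs, le_max_left _ _⟩, by simp [hgu]⟩
      · have : g (q n) = g s := hfib s t (q n) ⟨hqs.le, hu.1.trans hut⟩ h
        simp [hgu, this, excursion_nonneg hg]
  refine ⟨fun t => ∑' n, F n t, continuous_tsum
    (fun n => continuous_const.mul (continuous_excursion hg _)) hsumD hbound, hM, ?_⟩
  intro s t
  rcases le_total s t with h | h
  · exact hone s t h
  · rw [eq_comm, hone t s h, eq_comm]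

/-- The image of a path with distinct end points contains an arc with the same end points. -/
theorem Path.exists_isEmbedding_range_subset {X : Type*} [MetricSpace X] [CompactSpace X] {x y : X}
    (hxy : x ≠ y) (γ : Path x y) :
    ∃ f : I → X, IsEmbedding f ∧ f 0 = x ∧ f 1 = y ∧ range f ⊆ range γ := by
  obtain ⟨g₀, hg₀, h0, h1, hsub, hfib₀⟩ := exists_orderConnected_fibres γ.continuous_extend
  simp only [Path.extend_zero, Path.extend_one] at h0 h1
  set π : ℝ → ℝ := fun t => (projIcc (0 : ℝ) 1 zero_le_one t : ℝ) with hπ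
  have hπm : Monotone π := fun s t h => monotone_projIcc _ h
  have hπI : ∀ t, π t ∈ Icc (0 : ℝ) 1 := fun t => (projIcc (0 : ℝ) 1 zero_le_one t).2
  have hπc : Continuous π := continuous_subtype_val.comp continuous_projIcc
  have hπid : ∀ t : I, π t = t := fun t => by simp [hπ]
  set g : ℝ → X := g₀ ∘ π
  have hg : Continuous g := hg₀.comp_continuous hπc hπI
  have hfib : ∀ s t, ∀ u ∈ Icc s t, g s = g t → g u = g s := fun s t u hu h =>
    hfib₀ _ (hπI s) _ (hπI t) _ ⟨hπm hu.1, hπm hu.2⟩ h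
  obtain ⟨h, hc, hm, hiff⟩ := exists_monotone_same_fibres hg hfib
  have hg0 : g 0 = x := (congrArg g₀ (hπid 0)).trans h0
  have hg1 : g 1 = y := (congrArg g₀ (hπid 1)).trans h1
  have hlt : h 0 < h 1 := lt_of_le_of_ne (hm zero_le_one) fun he => hxy <| by
    rw [← hg0, ← hg1]; exact (hiff 0 1).1 he
  have hpos : 0 < h 1 - h 0 := sub_pos.2 hlt
  let k : I → I := fun t => ⟨(h t - h 0) / (h 1 - h 0),
    div_nonneg (sub_nonneg.2 (hm t.2.1)) hpos.le,
    (div_le_one hpos).2 (sub_le_sub_right (hm t.2.2) _)⟩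
  have hkc : Continuous k := by
    refine Continuous.subtype_mk ?_ _
    exact ((hc.comp continuous_subtype_val).sub continuous_const).div_const _
  have hk0 : k 0 = 0 := Subtype.ext (by simp [k])
  have hk1 : k 1 = 1 := Subtype.ext (by simp [k, hpos.ne'])
  have hks : Function.Surjective k := by
    intro z
    have hz : h 0 + z * (h 1 - h 0) ∈ Icc (h 0) (h 1) := by
      constructor <;> nlinarith [z.2.1, z.2.2]
    obtain ⟨t, ht, hht⟩ := intermediate_value_Icc zero_le_one hc.continuousOn hz
    refine ⟨⟨t, ht⟩, Subtype.ext ?_⟩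
    simp only [k, hht]
    field_simp
    ring
  have hkiff : ∀ s t : I, k s = k t ↔ g s = g t := by
    intro s t
    rw [← hiff s t, Subtype.ext_iff]
    simp only [k]
    rw [div_left_inj' hpos.ne', sub_left_inj]
  -- `k` is a quotient map of `[0,1]` onto itself with the fibres of `g`, so `g` factors through it
  -- as a continuous injection.
  have hkq : IsQuotientMap k := hkc.isClosedMap.isQuotientMap hkc hks
  obtain ⟨ρ, hρ⟩ := hks.hasRightInverse
  have hfk : ∀ t : I, g (ρ (k t)) = g t := fun t => (hkiff _ _).1 (hρ (k t))
  refine ⟨fun z => g (ρ z), ?_, ?_, ?_, ?_⟩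
  · refine (Continuous.isClosedEmbedding ?_ ?_).isEmbedding
    · rw [hkq.continuous_iff]
      refine (hg.comp continuous_subtype_val).congr fun t => (hfk t).symm
    · intro a b hab
      have := (hkiff (ρ a) (ρ b)).2 hab
      rwa [hρ, hρ] at this
  · simpa [hk0, hg0] using hfk 0
  · simpa [hk1, hg1] using hfk 1
  · rintro _ ⟨z, rfl⟩
    obtain ⟨t, ht, htz⟩ := hsub ⟨_, hπI (ρ z), rfl⟩
    exact ⟨⟨t, ht⟩, (γ.extend_apply ht).symm.trans htz⟩

/-! ### Counting small pieces along arcs -/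

section UniquelyArcwiseConnected

variable {X : Type*} [MetricSpace X]

/-- In a uniquely arcwise connected space, a set joining two points of an arc contains the subarc
between them. -/
lemma IsUniquelyArcwiseConnected.image_Icc_subset [CompactSpace X]
    (hX : IsUniquelyArcwiseConnected X) {f : I → X} (hf : IsEmbedding f) {C : Set X}
    {a b : I} (hab : a ≤ b) (hC : JoinedIn C (f a) (f b)) :
    f '' Icc a b ⊆ C := by
  rcases hab.eq_or_lt with rfl | hlt
  · simpa using hC.source_mem
  obtain ⟨γ, hγ⟩ := hC
  have hne : f a ≠ f b := hf.injective.ne hlt.ne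
  obtain ⟨f', hf', h0, h1, hsub⟩ := γ.exists_isEmbedding_range_subset hne
  have hlt' : (a : ℝ) < b := hlt
  set e := (iccHomeoI (a : ℝ) b hlt').symm with he
  let ι : Icc (a : ℝ) b → I := fun t => ⟨t, a.2.1.trans t.2.1, t.2.2.trans b.2.2⟩
  have hι : IsEmbedding ι := by
    refine IsEmbedding.of_comp (by fun_prop) continuous_subtype_val ?_
    exact IsEmbedding.subtypeVal
  have hemb : IsEmbedding (f ∘ ι ∘ e) := hf.comp (hι.comp e.isEmbedding)
  have hrange : range (f ∘ ι ∘ e) = f '' Icc a b := by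
    rw [range_comp, range_comp, e.surjective.range_eq, image_univ]
    congr 1
    ext t
    constructor
    · rintro ⟨u, rfl⟩
      exact ⟨u.2.1, u.2.2⟩
    · rintro ⟨h1, h2⟩
      exact ⟨⟨t, h1, h2⟩, rfl⟩
  have he0 : (e 0 : ℝ) = a := by simp [he]
  have he1 : (e 1 : ℝ) = b := by simp [he]
  have hι0 : ι (e 0) = a := Subtype.ext he0
  have hι1 : ι (e 1) = b := Subtype.ext he1
  have := (hX _ _ hne).unique ⟨f', hf', h0, h1, rfl⟩
    ⟨f ∘ ι ∘ e, hemb, by simp [hι0], by simp [hι1], hrange⟩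
  rw [← this]
  rintro _ hx
  obtain ⟨t, rfl⟩ := hsub hx
  exact hγ t

/-- `x` and `y` can be joined inside a union of at most `n` pathwise connected closed sets of
diameter less than `ε`. -/
def JoinedBySmallPieces (ε : ℝ) (n : ℕ) (x y : X) : Prop :=
  ∃ 𝒞 : Finset (Set X), 𝒞.card ≤ n ∧
    (∀ C ∈ 𝒞, IsClosed C ∧ Metric.diam C < ε ∧ ∀ a ∈ C, ∀ b ∈ C, JoinedIn C a b) ∧
    JoinedIn (⋃₀ (𝒞 : Set (Set X))) x y

lemma JoinedBySmallPieces.refl {ε : ℝ} (hε : 0 < ε) {n : ℕ} (hn : 0 < n) (x : X) :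
    JoinedBySmallPieces ε n x x := by
  refine ⟨{{x}}, by simpa using Nat.one_le_of_lt hn, ?_, ?_⟩
  · simp only [Finset.mem_singleton, forall_eq]
    refine ⟨isClosed_singleton, by simpa using hε, ?_⟩
    rintro a rfl b rfl
    exact JoinedIn.refl rfl
  · simp only [Finset.coe_singleton, sUnion_singleton]
    exact JoinedIn.refl rfl

lemma JoinedBySmallPieces.symm {ε : ℝ} {n : ℕ} {x y : X} (h : JoinedBySmallPieces ε n x y) :
    JoinedBySmallPieces ε n y x := by
  obtain ⟨𝒞, h1, h2, h3⟩ := h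
  exact ⟨𝒞, h1, h2, h3.symm⟩

lemma JoinedBySmallPieces.mono {ε : ℝ} {m n : ℕ} (hmn : m ≤ n) {x y : X}
    (h : JoinedBySmallPieces ε m x y) : JoinedBySmallPieces ε n x y := by
  obtain ⟨𝒞, h1, h2, h3⟩ := h
  exact ⟨𝒞, h1.trans hmn, h2, h3⟩

lemma JoinedBySmallPieces.trans {ε : ℝ} {m n : ℕ} {x y z : X}
    (hxy : JoinedBySmallPieces ε m x y) (hyz : JoinedBySmallPieces ε n y z) :
    JoinedBySmallPieces ε (m + n) x z := by
  classical
  obtain ⟨𝒞, h1, h2, h3⟩ := hxy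
  obtain ⟨𝒟, k1, k2, k3⟩ := hyz
  refine ⟨𝒞 ∪ 𝒟, (Finset.card_union_le _ _).trans (add_le_add h1 k1), ?_, ?_⟩
  · intro C hC
    rcases Finset.mem_union.1 hC with h | h
    · exact h2 C h
    · exact k2 C h
  · refine (h3.mono (sUnion_mono ?_)).trans (k3.mono (sUnion_mono ?_)) <;> simp

/-- A path whose restrictions to the intervals `[k / n, (k + 1) / n]` are small. -/
lemma joinedBySmallPieces_of_path {ε : ℝ} {n : ℕ} (hn : 0 < n) {g : ℝ → X}
    (hg : ContinuousOn g (Icc 0 1)) {η : ℝ} (hη : η < ε) (hη0 : 0 ≤ η)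
    (h : ∀ s ∈ Icc (0 : ℝ) 1, ∀ t ∈ Icc (0 : ℝ) 1, |s - t| ≤ 1 / n → dist (g s) (g t) ≤ η) :
    JoinedBySmallPieces ε n (g 0) (g 1) := by
  classical
  have hn' : (0 : ℝ) < n := Nat.cast_pos.2 hn
  set J : ℕ → Set ℝ := fun k => Icc ((k : ℝ) / n) ((k + 1 : ℝ) / n) with hJ
  have hJsub : ∀ k < n, J k ⊆ Icc 0 1 := by
    intro k hk t ht
    refine ⟨le_trans (by positivity) ht.1, ht.2.trans ?_⟩
    rw [div_le_one hn']
    exact_mod_cast hk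
  refine ⟨(Finset.range n).image fun k => g '' J k,
    Finset.card_image_le.trans (Finset.card_range n).le, ?_, ?_⟩
  · simp only [Finset.mem_image, Finset.mem_range, forall_exists_index, and_imp]
    rintro _ k hk rfl
    have hgk : ContinuousOn g (J k) := hg.mono (hJsub k hk)
    refine ⟨(isCompact_Icc.image_of_continuousOn hgk).isClosed, lt_of_le_of_lt ?_ hη, ?_⟩
    · refine Metric.diam_le_of_forall_dist_le hη0 ?_
      rintro _ ⟨s, hs, rfl⟩ _ ⟨t, ht, rfl⟩
      refine h s (hJsub k hk hs) t (hJsub k hk ht) ?_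
      have h1 : ((k : ℝ) + 1) / n = k / n + 1 / n := add_div _ _ _
      rw [abs_le]
      constructor <;> linarith [hs.1, hs.2, ht.1, ht.2]
    · have hpc : IsPathConnected (g '' J k) := by
        refine IsPathConnected.image' ?_ hgk
        exact (convex_Icc _ _).isPathConnected
          (nonempty_Icc.2 (div_le_div_of_nonneg_right (by linarith) hn'.le))
      exact fun a ha b hb => hpc.joinedIn a ha b hb
  · have hcov : g '' Icc 0 1 ⊆
        ⋃₀ ((Finset.range n).image fun k => g '' J k : Finset (Set X)) := by
      rintro _ ⟨t, ht, rfl⟩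
      rcases ht.2.eq_or_lt with rfl | hlt
      · refine ⟨g '' J (n - 1), ?_, 1, ⟨?_, ?_⟩, rfl⟩
        · simp only [Finset.coe_image, Finset.coe_range]
          exact ⟨n - 1, Nat.sub_lt hn one_pos, rfl⟩
        · rw [div_le_one hn']
          exact_mod_cast Nat.sub_le _ _
        · rw [Nat.cast_sub hn, Nat.cast_one, sub_add_cancel, div_self hn'.ne']
      · refine ⟨g '' J ⌊t * n⌋₊, ?_, t, ⟨?_, ?_⟩, rfl⟩
        · simp only [Finset.coe_image, Finset.coe_range]
          refine ⟨_, ?_, rfl⟩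
          rw [mem_Iio, Nat.floor_lt (mul_nonneg ht.1 hn'.le)]
          nlinarith
        · rw [div_le_iff₀ hn']
          exact Nat.floor_le (mul_nonneg ht.1 hn'.le)
        · rw [le_div_iff₀ hn']
          exact (Nat.lt_floor_add_one _).le
    have hpc : IsPathConnected (g '' Icc 0 1) :=
      ((convex_Icc (0 : ℝ) 1).isPathConnected ⟨0, by simp⟩).image' hg
    exact (hpc.joinedIn _ ⟨0, by simp, rfl⟩ _ ⟨1, by simp, rfl⟩).mono hcov

lemma Path.exists_joinedBySmallPieces {ε : ℝ} (hε : 0 < ε) {x y : X} (γ : Path x y) :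
    ∃ n, JoinedBySmallPieces ε n x y := by
  have huc : UniformContinuousOn γ.extend (Icc 0 1) :=
    isCompact_Icc.uniformContinuousOn_of_continuous γ.continuous_extend.continuousOn
  rw [Metric.uniformContinuousOn_iff] at huc
  obtain ⟨δ, hδ, H⟩ := huc (ε / 2) (half_pos hε)
  obtain ⟨n, hn⟩ := exists_nat_one_div_lt hδ
  refine ⟨n + 1, ?_⟩
  have := joinedBySmallPieces_of_path (ε := ε) (n := n + 1) (Nat.succ_pos n)
    γ.continuous_extend.continuousOn (half_lt_self hε) (half_pos hε).le fun s hs t ht hst =>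
      (H s hs t ht ((Real.dist_eq s t).trans_lt (lt_of_le_of_lt hst (by push_cast; exact hn)))).le
  simpa using this

lemma IsUniquelyArcwiseConnected.joined (hX : IsUniquelyArcwiseConnected X) (x y : X) :
    Joined x y := by
  by_cases h : x = y
  · rw [h]
  · obtain ⟨A, ⟨f, hf, h0, h1, -⟩, -⟩ := hX x y h
    exact ⟨⟨⟨f, hf.continuous⟩, h0, h1⟩⟩

/-- An arc whose end points are joined by `n` small pieces is cut by `2 n + 1` points into
small subarcs. -/
lemma IsUniquelyArcwiseConnected.exists_cut [CompactSpace X]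
    (hX : IsUniquelyArcwiseConnected X) {ε : ℝ} {n : ℕ} {f : I → X} (hf : IsEmbedding f)
    (h : JoinedBySmallPieces ε n (f 0) (f 1)) :
    ∃ t : Fin (2 * n + 1 + 2) → I, StrictMono t ∧ t 0 = 0 ∧ t (Fin.last (2 * n + 1 + 1)) = 1 ∧
      ∀ i : Fin (2 * n + 1 + 1), Metric.diam (f '' Icc (t i.castSucc) (t i.succ)) < ε := by
  classical
  obtain ⟨𝒞, hcard, hC, hjoin⟩ := h
  have hcov : ∀ t : I, ∃ C ∈ 𝒞, f t ∈ C := by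
    intro t
    have := hX.image_Icc_subset hf (zero_le_one (α := I)) hjoin ⟨t, ⟨t.2.1, t.2.2⟩, rfl⟩
    simpa using this
  -- Cut at the first and last parameter at which the arc meets each piece: at most `2 * n` points
  -- besides `0` and `1`. Padding to `2 * n + 3` points keeps the number of interior cuts positive
  -- even for `n = 0`.
  set E₀ : Finset I := insert 0 (insert 1
    (𝒞.image (fun C => sInf (f ⁻¹' C)) ∪ 𝒞.image (fun C => sSup (f ⁻¹' C)))) with hE₀
  have hE₀card : E₀.card ≤ 2 * n + 1 + 2 := by
    have h1 := Finset.card_insert_le (0 : I) (insert 1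
      (𝒞.image (fun C => sInf (f ⁻¹' C)) ∪ 𝒞.image (fun C => sSup (f ⁻¹' C))))
    have h2 := Finset.card_insert_le (1 : I)
      (𝒞.image (fun C => sInf (f ⁻¹' C)) ∪ 𝒞.image (fun C => sSup (f ⁻¹' C)))
    have h3 := Finset.card_union_le (𝒞.image (fun C => sInf (f ⁻¹' C)))
      (𝒞.image (fun C => sSup (f ⁻¹' C)))
    have h4 := Finset.card_image_le (s := 𝒞) (f := fun C => sInf (f ⁻¹' C))
    have h5 := Finset.card_image_le (s := 𝒞) (f := fun C => sSup (f ⁻¹' C))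
    rw [← hE₀] at h1
    omega
  have : Infinite I := (Icc_infinite zero_lt_one).to_subtype
  obtain ⟨E, hsub, hEcard⟩ := Infinite.exists_superset_card_eq E₀ _ hE₀card
  have h0E : (0 : I) ∈ E := hsub (by simp [hE₀])
  have h1E : (1 : I) ∈ E := hsub (by simp [hE₀])
  set t := E.orderEmbOfFin hEcard with ht
  have hmem : ∀ z ∈ E, ∃ j, t j = z := fun z hz => by
    have : z ∈ range t := by rw [ht, Finset.range_orderEmbOfFin]; exact hz
    exact this
  refine ⟨t, t.strictMono, ?_, ?_, ?_⟩
  · obtain ⟨j, hj⟩ := hmem 0 h0E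
    exact le_antisymm (hj ▸ t.monotone (Fin.zero_le j)) (t 0).2.1
  · obtain ⟨j, hj⟩ := hmem 1 h1E
    exact le_antisymm (t _).2.2 (hj ▸ t.monotone (Fin.le_last j))
  intro i
  have hlt : t i.castSucc < t i.succ := t.strictMono i.castSucc_lt_succ
  -- A piece `C` through `f m` has its first and last parameters among the cut points, hence outside
  -- the open interval between two adjacent ones; so the whole subarc lies in `C`.
  obtain ⟨m, hm1, hm2⟩ := exists_between hlt
  obtain ⟨C, hC𝒞, hmC⟩ := hcov m
  obtain ⟨hcl, hdiam, hpc⟩ := hC C hC𝒞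
  have hcpt : IsCompact (f ⁻¹' C) := (hcl.preimage hf.continuous).isCompact
  have hinf : sInf (f ⁻¹' C) ∈ f ⁻¹' C := hcpt.sInf_mem ⟨m, hmC⟩
  have hsup : sSup (f ⁻¹' C) ∈ f ⁻¹' C := hcpt.sSup_mem ⟨m, hmC⟩
  have hinfE : sInf (f ⁻¹' C) ∈ E := hsub (by
    simp only [hE₀, Finset.mem_insert, Finset.mem_union, Finset.mem_image]
    exact Or.inr (Or.inr (Or.inl ⟨C, hC𝒞, rfl⟩)))
  have hsupE : sSup (f ⁻¹' C) ∈ E := hsub (by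
    simp only [hE₀, Finset.mem_insert, Finset.mem_union, Finset.mem_image]
    exact Or.inr (Or.inr (Or.inr ⟨C, hC𝒞, rfl⟩)))
  have hle1 : sInf (f ⁻¹' C) ≤ m := sInf_le hmC
  have hle2 : m ≤ sSup (f ⁻¹' C) := le_sSup hmC
  have h1 : sInf (f ⁻¹' C) ≤ t i.castSucc := by
    obtain ⟨j, hj⟩ := hmem _ hinfE
    rw [← hj] at hle1 ⊢
    have : j < i.succ := t.lt_iff_lt.1 (hle1.trans_lt hm2)
    exact t.monotone (Fin.le_castSucc_iff.2 this)
  have h2 : t i.succ ≤ sSup (f ⁻¹' C) := by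
    obtain ⟨j, hj⟩ := hmem _ hsupE
    rw [← hj] at hle2 ⊢
    have : i.castSucc < j := t.lt_iff_lt.1 (hm1.trans_le hle2)
    exact t.monotone (Fin.castSucc_lt_iff_succ_le.1 this)
  refine (Metric.diam_mono ?_ hcl.isCompact.isBounded).trans_lt hdiam
  exact (image_mono (Icc_subset_Icc h1 h2)).trans
    (hX.image_Icc_subset hf (hle1.trans hle2) (hpc _ hinf _ hsup))

/-- Failure of uniform arcwise connectedness, seen from a base point. -/
lemma IsUniquelyArcwiseConnected.exists_forall_not_joinedBySmallPieces
    [CompactSpace X] (hX : IsUniquelyArcwiseConnected X)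
    (h : ¬ IsUniformlyArcwiseConnected X) (x₀ : X) :
    ∃ ε : ℝ, 0 < ε ∧ ∀ n, ∃ x, ¬ JoinedBySmallPieces ε n x₀ x := by
  simp only [IsUniformlyArcwiseConnected, not_forall] at h
  obtain ⟨ε, hε, H⟩ := h
  refine ⟨ε, hε, fun n => ?_⟩
  by_contra! hcon
  refine H ⟨2 * (n + n) + 1, Nat.succ_pos _, fun f hf => ?_⟩
  exact hX.exists_cut hf ((hcon (f 0)).symm.trans (hcon (f 1)))

end UniquelyArcwiseConnected

/-! ### Selections along a path of countable compact sets -/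

section Selections

variable {X : Type*} [MetricSpace X]

/-- In a countable compact set, chains with small steps stay near their starting point. -/
lemma IsCompact.exists_chain_control {K : Set X} (hK : IsCompact K) (hcount : K.Countable) {ε : ℝ}
    (hε : 0 < ε) :
    ∃ η > 0, ∀ (x : ℕ → X) (n : ℕ), (∀ i ≤ n, x i ∈ K) →
      (∀ i < n, dist (x i) (x (i + 1)) < η) → dist (x 0) (x n) < ε := by
  have key : ∀ᶠ η : ℝ in 𝓝 0, ∀ x₀ ∈ K, ∀ (x : ℕ → X) (n : ℕ), x 0 = x₀ → (∀ i ≤ n, x i ∈ K) →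
      (∀ i < n, dist (x i) (x (i + 1)) < η) → dist (x 0) (x n) < ε := by
    refine hK.eventually_forall_of_forall_eventually fun p hp => ?_
    -- Countability enters here: some radius `r` below `ε / 2` is the distance from `p` to no point
    -- of `K`. The part of `K` inside the ball is then compact, and short steps cannot leave it.
    obtain ⟨r, hr, hr0, hrε⟩ := ((hcount.image fun y => dist y p).dense_compl ℝ).exists_between
      (half_pos hε)
    have hsub : K ∩ Metric.closedBall p r ⊆ Metric.ball p r := fun y hy =>
      lt_of_le_of_ne hy.2 fun h => hr ⟨y, hy.1, h⟩
    obtain ⟨θ, hθ, hthick⟩ :=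
      (hK.inter_right Metric.isClosed_closedBall).exists_thickening_subset_open
        Metric.isOpen_ball hsub
    rw [nhds_prod_eq]
    filter_upwards [prod_mem_prod (Iio_mem_nhds hθ) (Metric.ball_mem_nhds p hr0)]
    rintro ⟨η, x₀⟩ ⟨hη, hx₀⟩ x n rfl hxK hstep
    simp only [mem_Iio] at hη hstep hx₀
    have hball : ∀ i ≤ n, x i ∈ Metric.ball p r := by
      intro i
      induction i with
      | zero => exact fun _ => hx₀
      | succ i ih =>
        intro hi
        refine hthick (Metric.mem_thickening_iff.2 ⟨x i, ⟨hxK i (by omega), ?_⟩, ?_⟩)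
        · exact Metric.ball_subset_closedBall (ih (by omega))
        · rw [dist_comm]
          exact (hstep i (by omega)).trans hη
    have h0 := hball 0 (Nat.zero_le n)
    have hn := hball n le_rfl
    rw [Metric.mem_ball] at h0 hn
    linarith [dist_triangle_right (x 0) (x n) p]
  obtain ⟨η, hη, hη0⟩ := ((key.filter_mono nhdsWithin_le_nhds).and
    (self_mem_nhdsWithin (s := Ioi (0 : ℝ)))).exists
  exact ⟨η, hη0, fun x n hxK hstep => hη _ (hxK 0 (Nat.zero_le n)) x n rfl hxK hstep⟩

/-- Chains with steps less than `δ` through the sets `β t`, for `t` in an interval of radius `δ`,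
have end points at distance less than `ε`. -/
def ChainControl (β : ℝ → NonemptyCompacts X) (ε δ : ℝ) : Prop :=
  ∀ s ∈ Icc (0 : ℝ) 1, ∀ (τ : ℕ → ℝ) (x : ℕ → X) (n : ℕ),
    (∀ i ≤ n, |τ i - s| < δ ∧ x i ∈ β (τ i)) →
      (∀ i < n, dist (x i) (x (i + 1)) < δ) → dist (x 0) (x n) < ε

/-- Near `s₀` the sets `β t` are Hausdorff-close to `β s₀`, so a chain through them is shadowed by a
chain in `β s₀` with slightly longer steps. Compactness of `[0,1]` makes `δ` uniform. -/
lemma exists_chainControl {β : ℝ → NonemptyCompacts X} (hβ : Continuous β)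
    (hcount : ∀ t, (β t : Set X).Countable) {ε : ℝ} (hε : 0 < ε) :
    ∃ δ > 0, ChainControl β ε δ := by
  have key : ∀ᶠ δ : ℝ in 𝓝 0, ∀ s ∈ Icc (0 : ℝ) 1, ∀ (τ : ℕ → ℝ) (x : ℕ → X) (n : ℕ),
    (∀ i ≤ n, |τ i - s| < δ ∧ x i ∈ β (τ i)) →
      (∀ i < n, dist (x i) (x (i + 1)) < δ) → dist (x 0) (x n) < ε := by
    refine isCompact_Icc.eventually_forall_of_forall_eventually fun s₀ _ => ?_
    obtain ⟨η₀, hη₀, hchain⟩ := (β s₀).isCompact.exists_chain_control (hcount s₀)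
      (by linarith : 0 < ε / 3)
    set η := min η₀ ε with hη
    have hηpos : 0 < η := lt_min hη₀ hε
    have hη1 : η ≤ η₀ := min_le_left _ _
    have hη2 : η ≤ ε := min_le_right _ _
    obtain ⟨ρ, hρ, hclose⟩ := Metric.continuousAt_iff.1 (hβ.continuousAt (x := s₀)) (η / 3)
      (by linarith)
    rw [nhds_prod_eq]
    filter_upwards [prod_mem_prod (Iio_mem_nhds (lt_min (by linarith : (0 : ℝ) < η / 3)
      (half_pos hρ))) (Metric.ball_mem_nhds s₀ (half_pos hρ))]
    rintro ⟨δ, s⟩ ⟨hδ, hs⟩ τ x n hx hstep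
    simp only [mem_Iio, lt_min_iff, Metric.mem_ball] at hδ hs hx hstep
    have hy : ∀ i, ∃ y, i ≤ n → y ∈ (β s₀ : Set X) ∧ dist (x i) y < η / 3 := by
      intro i
      by_cases hi : i ≤ n
      · obtain ⟨h1, h2⟩ := hx i hi
        have hd : dist (τ i) s₀ < ρ := by
          rw [← Real.dist_eq] at h1
          linarith [dist_triangle (τ i) s s₀]
        have := hclose hd
        rw [Metric.NonemptyCompacts.dist_eq] at this
        obtain ⟨y, hy, hxy⟩ := Metric.exists_dist_lt_of_hausdorffDist_lt h2 this
          (Metric.hausdorffEDist_ne_top_of_nonempty_of_bounded (β _).nonempty (β _).nonempty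
            (β _).isCompact.isBounded (β _).isCompact.isBounded)
        exact ⟨y, fun _ => ⟨hy, hxy⟩⟩
      · exact ⟨x 0, fun h => absurd h hi⟩
    choose y hy using hy
    have h1 := hchain y n (fun i hi => (hy i hi).1) fun i hi => by
      have h1 := (hy i hi.le).2
      have h2 := (hy (i + 1) hi).2
      have h3 := hstep i hi
      rw [dist_comm] at h1
      linarith [dist_triangle4 (y i) (x i) (x (i + 1)) (y (i + 1))]
    have h2 := (hy 0 (Nat.zero_le n)).2
    have h3 := (hy n le_rfl).2
    rw [dist_comm] at h3
    linarith [dist_triangle4 (x 0) (y 0) (y n) (x n)]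
  obtain ⟨δ, hδ, hδ0⟩ := ((key.filter_mono nhdsWithin_le_nhds).and
    (self_mem_nhdsWithin (s := Ioi (0 : ℝ)))).exists
  exact ⟨δ, hδ0, hδ⟩

/-- A path of compact sets has selections through every point of its initial set, with a modulus
of continuity that does not depend on the point. -/
lemma exists_selection [CompactSpace X] {β : ℝ → NonemptyCompacts X} (hβ : UniformContinuous β)
    {p : X} (hp : p ∈ β 0) :
    ∃ g : ℝ → X, g 0 = p ∧ (∀ t ∈ Icc (0 : ℝ) 1, g t ∈ β t) ∧
      ∀ ε δ : ℝ, 0 < δ → ChainControl β ε δ →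
        ∀ s ∈ Icc (0 : ℝ) 1, ∀ t ∈ Icc (0 : ℝ) 1, |s - t| < δ → dist (g s) (g t) ≤ ε := by
  have hnext : ∀ (x : X) (S : NonemptyCompacts X), ∃ y ∈ (S : Set X),
      Metric.infDist x S = dist x y := fun x S => S.isCompact.exists_infDist_eq_dist S.nonempty x
  choose nxt hnxt hnxtd using hnext
  -- Follow `p` along the grid of mesh `1 / (N + 1)`, moving each time to a nearest point of the
  -- next set. Steps are bounded by the Hausdorff distance of neighbouring sets.
  set P : ℕ → ℕ → X := fun N k =>
    Nat.rec p (fun k x => nxt x (β ((k + 1 : ℕ) / (N + 1 : ℝ)))) k with hP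
  have hPmem : ∀ N k : ℕ, P N k ∈ β (k / (N + 1 : ℝ)) := by
    intro N k
    cases k with
    | zero => simpa [hP] using hp
    | succ k => exact hnxt _ _
  have hfin : ∀ S T : NonemptyCompacts X, Metric.hausdorffEDist (S : Set X) T ≠ ⊤ := fun S T =>
    Metric.hausdorffEDist_ne_top_of_nonempty_of_bounded S.nonempty T.nonempty
      S.isCompact.isBounded T.isCompact.isBounded
  have hPdist : ∀ N k : ℕ, dist (P N k) (P N (k + 1)) ≤
      dist (β (k / (N + 1 : ℝ))) (β ((k + 1 : ℕ) / (N + 1 : ℝ))) := by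
    intro N k
    rw [Metric.NonemptyCompacts.dist_eq]
    refine le_trans (le_of_eq ?_) (Metric.infDist_le_hausdorffDist_of_mem (hPmem N k) (hfin _ _))
    exact (hnxtd _ _).symm
  have hinv : Tendsto (fun N : ℕ => 1 / ((N : ℝ) + 1)) atTop (𝓝 0) :=
    tendsto_one_div_add_atTop_nhds_zero_nat
  have hclose : ∀ η > 0, ∀ᶠ N : ℕ in atTop, ∀ s t : ℝ, |s - t| ≤ 1 / (N + 1) →
      dist (β s) (β t) < η := by
    intro η hη
    obtain ⟨δ, hδ, H⟩ := Metric.uniformContinuous_iff.1 hβ η hη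
    filter_upwards [hinv.eventually_lt_const hδ] with N hN s t hst
    exact H ((Real.dist_eq s t).trans_lt (hst.trans_lt hN))
  have hfloor : ∀ N : ℕ, ∀ t : ℝ, 0 ≤ t → (⌊t * (N + 1)⌋₊ : ℝ) / (N + 1) ≤ t ∧
      t < (⌊t * (N + 1)⌋₊ : ℝ) / (N + 1) + 1 / (N + 1) := by
    intro N t ht
    have hN : (0 : ℝ) < N + 1 := by positivity
    rw [← add_div, div_le_iff₀ hN, lt_div_iff₀ hN]
    exact ⟨Nat.floor_le (by positivity), Nat.lt_floor_add_one _⟩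
  set G : ℕ → ℝ → X := fun N t => P N ⌊t * (N + 1)⌋₊ with hG
  -- One free ultrafilter gives limits at all `t` simultaneously. Chain control at the grid stages
  -- passes to the limit and makes it continuous.
  set 𝒰 : Ultrafilter ℕ := hyperfilter ℕ
  have h𝒰 : (𝒰 : Filter ℕ) ≤ atTop := Nat.hyperfilter_le_atTop
  have hlim : ∀ t, ∃ x, Tendsto (fun N => G N t) 𝒰 (𝓝 x) := by
    intro t
    obtain ⟨x, -, hx⟩ := isCompact_univ.ultrafilter_le_nhds (𝒰.map fun N => G N t) (by simp)
    exact ⟨x, hx⟩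
  choose g hg using hlim
  refine ⟨g, ?_, ?_, ?_⟩
  · refine tendsto_nhds_unique (hg 0) ?_
    simp [hG, hP]
  · intro t ht
    have h1 : Tendsto (fun N => Metric.infDist (G N t) (β t)) 𝒰
        (𝓝 (Metric.infDist (g t) (β t))) :=
      ((Metric.continuous_infDist_pt _).tendsto _).comp (hg t)
    have h2 : Metric.infDist (g t) (β t) ≤ 0 := by
      refine le_of_forall_pos_le_add fun η hη => ?_
      rw [zero_add]
      refine le_of_tendsto h1 (h𝒰 ?_)
      filter_upwards [hclose η hη] with N hN
      refine (Metric.infDist_le_hausdorffDist_of_mem (hPmem N _) (hfin _ _)).trans ?_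
      rw [← Metric.NonemptyCompacts.dist_eq]
      refine (hN _ _ ?_).le
      have := hfloor N t ht.1
      rw [abs_le]
      constructor <;> linarith [this.1, this.2, (by positivity : (0 : ℝ) ≤ 1 / (N + 1))]
    exact ((β t).isCompact.isClosed.mem_iff_infDist_zero (β t).nonempty).2
      (le_antisymm h2 Metric.infDist_nonneg)
  · intro ε δ hδ hctrl
    have main : ∀ s ∈ Icc (0 : ℝ) 1, ∀ t ∈ Icc (0 : ℝ) 1, s ≤ t → |s - t| < δ →
        dist (g s) (g t) ≤ ε := by
      intro s hs t ht hst hd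
      refine le_of_tendsto ((hg s).dist (hg t)) (h𝒰 ?_)
      filter_upwards [hclose δ hδ, hinv.eventually_lt_const hδ] with N hN hNδ
      have hN0 : (0 : ℝ) < N + 1 := by positivity
      have hij : ⌊s * (N + 1)⌋₊ ≤ ⌊t * (N + 1)⌋₊ := by gcongr
      obtain ⟨n, hn⟩ := Nat.exists_eq_add_of_le hij
      have hsf := hfloor N s hs.1
      have htf := hfloor N t ht.1
      have := hctrl s hs (fun i => (⌊s * (N + 1)⌋₊ + i : ℕ) / (N + 1 : ℝ))
        (fun i => P N (⌊s * (N + 1)⌋₊ + i)) n ?_ ?_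
      · simp only [hG]
        rw [hn]
        exact this.le
      · intro i hi
        refine ⟨?_, hPmem _ _⟩
        have h1 : ((⌊s * (N + 1)⌋₊ : ℕ) : ℝ) / (N + 1) ≤
            ((⌊s * (N + 1)⌋₊ + i : ℕ) : ℝ) / (N + 1) := by
          gcongr
          omega
        have h2 : ((⌊s * (N + 1)⌋₊ + i : ℕ) : ℝ) / (N + 1) ≤ (⌊t * (N + 1)⌋₊ : ℝ) / (N + 1) := by
          gcongr
          omega
        rw [abs_lt] at hd ⊢
        constructor <;> linarith [hsf.1, hsf.2, htf.1, hd.1]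
      · intro i _
        refine (hPdist N _).trans_lt (hN _ _ ?_)
        rw [← sub_div, Nat.cast_succ, sub_add_cancel_left, abs_div, abs_neg, abs_one,
          abs_of_pos hN0]
    intro s hs t ht hd
    rcases le_total s t with h | h
    · exact main s hs t ht h hd
    · rw [dist_comm]
      rw [abs_sub_comm] at hd
      exact main t ht s hs h hd

/-- Points of the initial set of a path of convergent sequences are joined, by a bounded number of
small pieces, to points of the final set. -/
lemma ConvergentSequences.exists_joinedBySmallPieces [CompactSpace X]
    {f : I → ConvergentSequences X} (hf : Continuous f) {ε : ℝ} (hε : 0 < ε) :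
    ∃ n, ∀ p ∈ (f 0).1, ∃ q ∈ (f 1).1, JoinedBySmallPieces ε n p q := by
  set β : ℝ → NonemptyCompacts X := fun t => (f (projIcc 0 1 zero_le_one t)).1 with hβdef
  have hβ : UniformContinuous β :=
    (CompactSpace.uniformContinuous_of_continuous (continuous_subtype_val.comp hf)).comp
      (LipschitzWith.projIcc zero_le_one).uniformContinuous
  have hcount : ∀ t, (β t : Set X).Countable := fun t => (f (projIcc 0 1 zero_le_one t)).2.1
  have h0 : β 0 = (f 0).1 := by simp [hβdef]
  have h1 : β 1 = (f 1).1 := by simp [hβdef]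
  obtain ⟨δ, hδ, hctrl⟩ := exists_chainControl hβ.continuous hcount (half_pos hε)
  obtain ⟨n, hn⟩ := exists_nat_one_div_lt hδ
  refine ⟨n + 1, fun p hp => ?_⟩
  obtain ⟨g, hg0, hgmem, hgc⟩ := exists_selection hβ (h0.symm ▸ hp)
  have hgcont : ContinuousOn g (Icc 0 1) := by
    rw [Metric.continuousOn_iff]
    intro t ht η hη
    obtain ⟨θ, hθ, hθc⟩ := exists_chainControl hβ.continuous hcount (half_pos hη)
    exact ⟨θ, hθ, fun s hs hst => (hgc _ θ hθ hθc s hs t ht hst).trans_lt (half_lt_self hη)⟩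
  refine ⟨g 1, h1 ▸ hgmem 1 (by simp), ?_⟩
  rw [← hg0]
  refine joinedBySmallPieces_of_path (Nat.succ_pos n) hgcont (half_lt_self hε) (half_pos hε).le
    fun s hs t ht hst => hgc _ δ hδ hctrl s hs t ht (lt_of_le_of_lt hst ?_)
  push_cast
  exact hn

end Selections

/-! ### Subsequences and their coding by sets of natural numbers -/

/-- A set consisting of a limit point and infinitely many distinct terms of a sequence. -/
noncomputable def subsequenceSet {X : Type*} [TopologicalSpace X] {x : ℕ → X} {a : X}
    (hx : Tendsto x atTop (𝓝 a)) (hinj : Function.Injective x) (K : Set ℕ) (hK : K.Infinite) :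
    ConvergentSequences X :=
  have htend : Tendsto (fun k : K => x k) cofinite (𝓝 a) := by
    rw [← Nat.cofinite_eq_atTop] at hx
    exact hx.comp Subtype.val_injective.tendsto_cofinite
  ⟨⟨⟨insert a (range fun k : K => x k), htend.isCompact_insert_range_of_cofinite⟩,
      insert_nonempty _ _⟩, by
    refine ⟨(countable_range _).insert a, ?_, a, mem_insert _ _, fun U hU haU => ?_⟩
    · have := hK.to_subtype
      exact (infinite_range_of_injective (hinj.comp Subtype.val_injective)).mono
        (subset_insert _ _)
    · have : {k : K | x k ∉ U}.Finite := htend.eventually (hU.mem_nhds haU)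
      refine (this.image fun k : K => x k).subset ?_
      rintro _ ⟨rfl | ⟨k, rfl⟩, hkU⟩
      · exact absurd haU hkU
      · exact ⟨k, hkU, rfl⟩⟩

lemma mem_subsequenceSet {X : Type*} [TopologicalSpace X] {x : ℕ → X} {a : X}
    {hx : Tendsto x atTop (𝓝 a)} {hinj : Function.Injective x} {K : Set ℕ} {hK : K.Infinite}
    {y : X} : y ∈ (subsequenceSet hx hinj K hK).1 ↔ y = a ∨ ∃ k ∈ K, x k = y := by
  change y ∈ insert a (range fun k : K => x k) ↔ _
  simp

/-- An infinite set of natural numbers that determines `A` up to finite sets. -/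
def codeSet (A : Set ℕ) : Set ℕ :=
  {n | n.unpair.1 = 0 ∨ n.unpair.1 - 1 ∈ A}

lemma infinite_codeSet (A : Set ℕ) : (codeSet A).Infinite := by
  refine (infinite_range_of_injective (f := fun j => Nat.pair 0 j) ?_).mono ?_
  · intro i j h
    simpa using h
  · rintro _ ⟨j, rfl⟩
    simp [codeSet]

/-- A single element of `A` outside `B` puts a whole infinite column of the pairing into the
difference. -/
lemma subset_of_finite_codeSet_diff {A B : Set ℕ} (h : (codeSet A \ codeSet B).Finite) :
    A ⊆ B := by
  intro a ha
  by_contra hb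
  refine (infinite_range_of_injective (f := fun j => Nat.pair (a + 1) j) ?_) (h.subset ?_)
  · intro i j h
    simpa using h
  · rintro _ ⟨j, rfl⟩
    simp [codeSet, ha, hb]

/-! ### Spread sequences and cardinality -/

section

variable {X : Type*} [MetricSpace X] [CompactSpace X]

open Classical in
/-- A convergent sequence whose terms are farther and farther apart, in the sense of the number of
small pieces needed to join them to one another. -/
lemma exists_spread_sequence {ε : ℝ} (hε : 0 < ε) {x₀ : X} (hjoin : ∀ x, Joined x₀ x)
    (hunb : ∀ n, ∃ x, ¬ JoinedBySmallPieces ε n x₀ x) :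
    ∃ (x : ℕ → X) (a : X), Tendsto x atTop (𝓝 a) ∧ Function.Injective x ∧
      ∀ n, ∀ᶠ k in atTop, ¬ JoinedBySmallPieces ε n (x k) a ∧
        ∀ l, JoinedBySmallPieces ε n (x k) (x l) → l = k := by
  have hex : ∀ x, ∃ n, JoinedBySmallPieces ε n x₀ x := fun x =>
    (hjoin x).somePath.exists_joinedBySmallPieces hε
  set r : X → ℕ := fun x => Nat.find (hex x) with hr
  have hspec : ∀ x, JoinedBySmallPieces ε (r x) x₀ x := fun x => Nat.find_spec (hex x)
  have hrtri : ∀ {n x y}, JoinedBySmallPieces ε n x y → r y ≤ r x + n := fun h =>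
    Nat.find_min' (hex _) ((hspec _).trans h)
  choose u hu using hunb
  have hru : ∀ n, n < r (u n) := fun n => by
    by_contra! h
    exact hu n ((hspec _).mono h)
  obtain ⟨a, φ, hφ, hlim⟩ := CompactSpace.tendsto_subseq u
  -- Here `r` counts the pieces needed from `x₀`. It is unbounded along every subsequence of `u`, so
  -- terms can be chosen with its jumps growing; by `hrtri` such jumps forbid joining by few pieces.
  have hnext : ∀ k m : ℕ, ∃ m', m < m' ∧ r (u (φ m)) + k < r (u (φ m')) := by
    intro k m
    refine ⟨max (m + 1) (r (u (φ m)) + k), by omega, ?_⟩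
    exact ((le_max_right _ _).trans (hφ.le_apply)).trans_lt (hru _)
  choose F hF1 hF2 using hnext
  set ψ : ℕ → ℕ := fun k => Nat.rec 0 F k with hψdef
  have hψ : StrictMono ψ := strictMono_nat_of_lt_succ fun k => hF1 k (ψ k)
  set x : ℕ → X := fun k => u (φ (ψ k)) with hx
  have hstep : ∀ k, r (x k) + k < r (x (k + 1)) := fun k => hF2 k (ψ k)
  have hrm : StrictMono fun k => r (x k) := strictMono_nat_of_lt_succ fun k =>
    lt_of_le_of_lt (Nat.le_add_right _ _) (hstep k)
  have hgap : ∀ k l, k < l → r (x k) + k < r (x l) := fun k l hkl =>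
    (hstep k).trans_le (hrm.monotone hkl)
  refine ⟨x, a, hlim.comp hψ.tendsto_atTop, fun k l h => hrm.injective (congrArg r h), ?_⟩
  intro n
  filter_upwards [eventually_gt_atTop (r a + n + 1)] with k hk
  refine ⟨fun h => ?_, fun l h => ?_⟩
  · have h1 := hrtri h.symm
    have h2 := hrm.le_apply (x := k)
    omega
  · rcases lt_trichotomy l k with hlk | hlk | hlk
    · exfalso
      have h1 := hrtri h.symm
      -- The jump after `l` may be small when `l` is, so for `l < k - 1` the jump from `k - 1` to
      -- `k` is used instead.
      rcases Nat.lt_or_ge l (k - 1) with h2 | h2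
      · have h3 := hgap (k - 1) k (by omega)
        have h4 := hrm h2
        simp only at h4
        omega
      · have h3 := hgap l k hlk
        omega
    · exact hlk
    · exfalso
      have h1 := hrtri h
      have h2 := hgap k l hlk
      omega

lemma exists_joinedBySmallPieces_of_mem_arcComponent {S T : ConvergentSequences X}
    (h : T ∈ arcComponent S) {ε : ℝ} (hε : 0 < ε) :
    ∃ n, ∀ p ∈ S.1, ∃ q ∈ T.1, JoinedBySmallPieces ε n p q := by
  rcases h with rfl | ⟨A, f, hf, rfl, rfl, -⟩
  · exact ⟨1, fun p hp => ⟨p, hp, .refl hε one_pos p⟩⟩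
  · exact ConvergentSequences.exists_joinedBySmallPieces hf.continuous hε

/-- The compact metric space `NonemptyCompacts X` is Polish, hence empty or a continuous image of
Baire space. -/
lemma mk_convergentSequences_le_continuum :
    Cardinal.mk (ConvergentSequences X) ≤ Cardinal.continuum := by
  rcases isEmpty_or_nonempty (NonemptyCompacts X) with h | h
  · simp
  obtain ⟨F, -, hF⟩ := PolishSpace.exists_nat_nat_continuous_surjective (NonemptyCompacts X)
  refine (Cardinal.mk_subtype_le _).trans ?_
  have := Cardinal.lift_mk_le_lift_mk_of_surjective hF
  simpa using this

end

/-! ### The main theorem -/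

theorem mainTheorem2 {X : Type*} [MetricSpace X] [CompactSpace X] [ConnectedSpace X]
    (hX : IsUniquelyArcwiseConnected X) :
    (¬ IsUniformlyArcwiseConnected X →
      Cardinal.mk (arcComponents (ConvergentSequences X)) = Cardinal.continuum) ∧
    (IsArcwiseConnected (ConvergentSequences X) → IsUniformlyArcwiseConnected X) := by
  have main : ¬ IsUniformlyArcwiseConnected X →
      Cardinal.mk (arcComponents (ConvergentSequences X)) = Cardinal.continuum := by
    intro hnot
    refine le_antisymm (Cardinal.mk_range_le.trans mk_convergentSequences_le_continuum) ?_
    obtain ⟨x₀⟩ : Nonempty X := inferInstance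
    obtain ⟨ε, hε, hunb⟩ := hX.exists_forall_not_joinedBySmallPieces hnot x₀
    obtain ⟨x, a, hlim, hinj, hspread⟩ := exists_spread_sequence hε (hX.joined x₀) hunb
    set S : Set ℕ → ConvergentSequences X := fun A =>
      subsequenceSet hlim hinj (codeSet A) (infinite_codeSet A)
    -- With a bound `n` for the pieces, a term `x k` with `k` large can be joined neither to the
    -- limit nor to another term, so `k` must itself be an index of `S B`.
    have hsub : ∀ A B, S B ∈ arcComponent (S A) → A ⊆ B := by
      intro A B hAB
      obtain ⟨n, hn⟩ := exists_joinedBySmallPieces_of_mem_arcComponent hAB hε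
      obtain ⟨N, hN⟩ := eventually_atTop.1 (hspread n)
      refine subset_of_finite_codeSet_diff ((finite_lt_nat N).subset ?_)
      rintro k ⟨hkA, hkB⟩
      by_contra hkN
      obtain ⟨h1, h2⟩ := hN k (not_lt.1 hkN)
      obtain ⟨q, hq, hkq⟩ := hn (x k) (mem_subsequenceSet.2 (Or.inr ⟨k, hkA, rfl⟩))
      rcases mem_subsequenceSet.1 hq with rfl | ⟨l, hl, rfl⟩
      · exact h1 hkq
      · exact hkB (h2 l hkq ▸ hl)
    have hS : Function.Injective fun A : Set ℕ =>
        (⟨arcComponent (S A), S A, rfl⟩ : arcComponents (ConvergentSequences X)) := by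
      intro A B h
      have h' : arcComponent (S A) = arcComponent (S B) := congrArg Subtype.val h
      exact Subset.antisymm (hsub A B (h' ▸ Or.inl rfl)) (hsub B A (h' ▸ Or.inl rfl))
    simpa using Cardinal.lift_mk_le_lift_mk_of_injective hS
  refine ⟨main, fun harc => ?_⟩
  by_contra hnot
  have hsubs : (arcComponents (ConvergentSequences X)).Subsingleton := by
    have huniv : ∀ S : ConvergentSequences X, arcComponent S = univ := fun S =>
      eq_univ_of_forall fun T => by
        by_cases h : T = S
        · exact Or.inl h
        · exact Or.inr (harc S T (Ne.symm h))
    rintro _ ⟨S, rfl⟩ _ ⟨T, rfl⟩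
    rw [huniv, huniv]
  have h1 := Cardinal.mk_le_one_iff_set_subsingleton.2 hsubs
  rw [main hnot] at h1
  exact absurd h1 (not_le.2 (by simpa using Cardinal.nat_lt_continuum 1))
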